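/- Let $\mathcal A$ be an abelian category, linear over a finite field $k$, that is finitary ($|\mathrm{Hom}_{\mathcal A}(X,Y)|<\infty$ and $|\mathrm{Ext}^1_{\mathcal A}(X,Y)|<\infty$ for all $X,Y$) and hereditary ($\mathrm{Ext}^2_{\mathcal A}(X,Y)=0$ for all $X,Y$). Let $\mathrm{Iso}(\mathcal A)$ be the set of isomorphism classes of objects, $a_X=|\mathrm{Aut}(X)|$, let $g^{Z}_{XY}$ be the number of subobjects $L\subseteq Z$ with $L\cong Y$ and $Z/L\cong X$, and let $\langle X,Y\rangle=|\mathrm{Hom}_{\mathcal A}(X,Y)|/|\mathrm{Ext}^1_{\mathcal A}(X,Y)|$. Let $t\ge 1$ and $\mathbb Z_t=\mathbb Z/t$. Let $\mathcal C_t(\mathcal A)$ be the category of $t$-periodic complexes, that is, of families $C^\bullet=(C^i,d^i_{C^\bullet}:C^i\to C^{i+1})_{i\in\mathbb Z_t}$ with $d^{i+1}_{C^\bullet}d^i_{C^\bullet}=0$, with the usual chain maps. Let $(A_1^i)$, $(A_2^i)$, $(X^i)$, $(S^i)$, $i\in\mathbb Z_t$, be families of objects of $\mathcal A$, and put $A_1^\bullet=(A_1^i,0)$,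 $A_2^\bullet=(A_2^i,0)$. Let $\varepsilon\subseteq \mathrm{Ext}^1_{\mathcal C_t(\mathcal A)}(A_1^\bullet,A_2^\bullet)$ be the set of classes of short exact sequences $0\to A_2^\bullet\to C^\bullet\to A_1^\bullet\to 0$ in $\mathcal C_t(\mathcal A)$ such that $\mathrm H^i(C^\bullet)\cong X^i$ and $\mathrm{Im}(d^i_{C^\bullet})\cong S^{i+1}$ for all $i\in\mathbb Z_t$. Then $\varepsilon$ is finite, and $$|\varepsilon|=\sum_{\substack{M^j,N^j\in\mathrm{Iso}(\mathcal A)\\ j\in\mathbb Z_t}}\ \prod_{i\in\mathbb Z_t}\frac{g^{A_1^i}_{S^{i+1}M^i}\,g^{X^i}_{M^iN^i}\,g^{A_2^i}_{N^iS^i}\,a_{M^i}\,a_{N^i}\,a_{S^i}\,|\mathrm{Hom}_{\mathcal A}(A_1^i,A_2^i)|}{a_{X^i}\,\langle A_1^i,S^i\rangle\,\langle S^{i+1},N^i\rangle},$$ where only finitely many terms of the sum are nonzero. -/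

import Mathlib

open CategoryTheory CategoryTheory.Limits CategoryTheory.Abelian

universe v u

namespace PeriodicHall

noncomputable section

/-- The smallness condition needed to form Mathlib's `Ext`-groups in some universe; it holds in
every abelian category. -/
instance hasExt (C : Type u) [Category.{v} C] [Abelian C] : HasExt.{max u v} C :=
  HasExt.standard C

section Abelian

variable {C : Type u} [Category.{v} C] [Abelian C]

/-- The Hall number `g^Z_{XY}`: the number of subobjects `L` of `Z` with `L ≅ Y` and
`Z / L ≅ X`. -/
def hallNumber (X Y Z : C) : ℕ :=
  Nat.card {L : Subobject Z // Nonempty ((L : C) ≅ Y) ∧ Nonempty (cokernel L.arrow ≅ X)}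

/-- `a_X`, the order of the automorphism group of `X`. -/
def autCard (X : C) : ℕ := Nat.card (Aut X)

/-- The multiplicative Euler form `⟨X, Y⟩ = |Hom(X, Y)| / |Ext¹(X, Y)|`. -/
def eulerForm (X Y : C) : ℚ := (Nat.card (X ⟶ Y) : ℚ) / (Nat.card (Ext X Y 1) : ℚ)

/-- `Ext¹(X, Y)_Z`: the classes in `Ext¹(X, Y)` of the short exact sequences
`0 ⟶ Y ⟶ Z ⟶ X ⟶ 0` with middle term `Z`. -/
def extWithMiddle (X Y Z : C) : Set (Ext X Y 1) :=
  {e | ∃ (i : Y ⟶ Z) (p : Z ⟶ X) (w : i ≫ p = 0) (h : (ShortComplex.mk i p w).ShortExact),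
    h.extClass = e}

variable (C) in
/-- The isomorphism classes of objects of `C`. -/
abbrev IsoClass : Type u := Quotient (isIsomorphicSetoid C)

end Abelian

variable (C : Type u) [Category.{v} C] [Abelian C] (t : ℕ)

/-- The category of `t`-periodic complexes over `C`: objects `M i` for `i : ℤ/t` together with
differentials `M i ⟶ M (i + 1)` whose consecutive composites vanish. -/
abbrev PeriodicComplex : Type (max u v) := HomologicalComplex C (ComplexShape.up (ZMod t))

variable {C t}

/-- The `t`-periodic complex `(A i, 0)` with zero differentials. -/
def zeroDiff (A : ZMod t → C) : PeriodicComplex C t where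
  X := A
  d _ _ := 0

/-- The set `ε` of the extension classes in `Ext¹(A₁, A₂)`, taken in the category of `t`-periodic
complexes with `A₁` and `A₂` carrying zero differentials, whose middle term `K` has homology `X`
and satisfies `Im (dⁱ) ≅ S (i + 1)` for all `i`. As the class of an extension determines its middle
term up to isomorphism, this is the disjoint union, over the isomorphism classes of such `K`, of
the sets `Ext¹(A₁, A₂)_K`. -/
def extensionClasses (A₁ A₂ X S : ZMod t → C) : Set (Ext (zeroDiff A₁) (zeroDiff A₂) 1) :=
  ⋃ (K : PeriodicComplex C t) (_ : ∀ i, Nonempty (K.homology i ≅ X i))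
    (_ : ∀ i, Nonempty (image (K.d i (i + 1)) ≅ S (i + 1))),
    extWithMiddle (zeroDiff A₁) (zeroDiff A₂) K

/-- The product over `i : ℤ/t` that is the summand belonging to the families `M` and `N`. -/
def summand [NeZero t] (A₁ A₂ X S M N : ZMod t → C) : ℚ :=
  ∏ i : ZMod t,
    ((hallNumber (S (i + 1)) (M i) (A₁ i) : ℚ) * hallNumber (M i) (N i) (X i) *
        hallNumber (N i) (S i) (A₂ i) *
        autCard (M i) * autCard (N i) * autCard (S i) * Nat.card (A₁ i ⟶ A₂ i)) /
      (autCard (X i) * eulerForm (A₁ i) (S i) * eulerForm (S (i + 1)) (N i))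

end

end PeriodicHall

/-! Let `K` be an extension of `A₁` by `A₂`. Both ends have zero differential, so `d i` kills `A₂ i`
and lands in `A₂ (i + 1)`: it is `K i ↠ A₁ i ⟶ A₂ (i + 1) ↪ K (i + 1)` for a unique `δ i`.
Conversely any family `δ` and any classes `ξ i` in `Ext¹(A₁ i, A₂ i)` occur, since `d ≫ d = 0` is
automatic. Classes of extensions are therefore pairs `(δ, ξ)` (`nonempty_extensionClasses_equiv`).

The image of `d i` is that of `δ i`, and the homology in degree `i` is an extension of `M = ker (δ
i)` by `N = coker (δ (i - 1))` whose class is the image of `ξ i` under `Ext¹(A₁ i, A₂ i) → Ext¹(M,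
N)` (`extTransfer_mem_iff_homology`). The maps `δ i` with prescribed kernel, image and cokernel are
counted by `card_hom_kernel_image_cokernel`.

For fixed `δ`, heredity makes the transfer map surjective, so all its fibres have `|Ext¹(A₁ i, A₂
i)| / |Ext¹(M, N)|` elements, and Riedtmann's formula (`card_extWithMiddle_mul_autCard`) counts the
classes in `Ext¹(M, N)` with middle term `X i`. Bimultiplicativity of the Euler form, `⟨A₁ i, A₂ i⟩
= ⟨A₁ i, S i⟩ ⟨M, N⟩ ⟨S (i + 1), N⟩`, eliminates the `Ext` orders (`card_extTransfer_mem`). Grouping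
the `δ` by the classes of their kernels and cokernels gives the sum. -/

namespace PeriodicHall

/-! ### `Ext¹` as classes of short exact sequences -/

section YonedaExt

variable {C : Type u} [Category.{v} C] [Abelian C]

/-- A morphism of short exact sequences relates their classes. -/
lemma extClass_comp_mk₀ {Y Z X Y' Z' X' : C} {i : Y ⟶ Z} {p : Z ⟶ X} {w : i ≫ p = 0}
    {i' : Y' ⟶ Z'} {p' : Z' ⟶ X'} {w' : i' ≫ p' = 0}
    (h : (ShortComplex.mk i p w).ShortExact) (h' : (ShortComplex.mk i' p' w').ShortExact)
    (a : Y ⟶ Y') (b : Z ⟶ Z') (c : X ⟶ X') (hi : a ≫ i' = i ≫ b) (hp : b ≫ p' = p ≫ c) :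
    h.extClass.comp (Ext.mk₀ a) (add_zero 1) = (Ext.mk₀ c).comp h'.extClass (zero_add 1) :=
  h.extClass_naturality h' { τ₁ := a, τ₂ := b, τ₃ := c, comm₁₂ := hi, comm₂₃ := hp }

lemma extClass_eq_of_hom {Y Z X Z' : C} {i : Y ⟶ Z} {p : Z ⟶ X} {w : i ≫ p = 0}
    {i' : Y ⟶ Z'} {p' : Z' ⟶ X} {w' : i' ≫ p' = 0}
    (h : (ShortComplex.mk i p w).ShortExact) (h' : (ShortComplex.mk i' p' w').ShortExact)
    (b : Z ⟶ Z') (hi : i ≫ b = i') (hp : b ≫ p' = p) : h.extClass = h'.extClass := by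
  simpa using extClass_comp_mk₀ h h' (𝟙 Y) b (𝟙 X) (by simp [hi]) (by simp [hp])

/-- Short exact sequences with the same class are isomorphic. -/
lemma exists_iso_of_extClass_eq {Y Z X Z' : C} {i : Y ⟶ Z} {p : Z ⟶ X} {w : i ≫ p = 0}
    {i' : Y ⟶ Z'} {p' : Z' ⟶ X} {w' : i' ≫ p' = 0}
    (h : (ShortComplex.mk i p w).ShortExact) (h' : (ShortComplex.mk i' p' w').ShortExact)
    (he : h.extClass = h'.extClass) : ∃ e : Z ≅ Z', i ≫ e.hom = i' ∧ e.hom ≫ p' = p := by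
  have : Mono i := h.mono_f
  have : Mono i' := h'.mono_f
  have : Epi p := h.epi_g
  have : Epi p' := h'.epi_g
  -- The common class dies after pulling back along `p`, so `p` lifts to `f : Z ⟶ Z'`.
  obtain ⟨x, hx⟩ := Ext.covariant_sequence_exact₃ Z h' (Ext.mk₀ p) (zero_add 1)
    (by rw [← he]; exact h.comp_extClass)
  obtain ⟨f, rfl⟩ := (Ext.mk₀_bijective _ _).2 x
  have hf : f ≫ p' = p := by
    apply (Ext.mk₀_bijective _ _).1
    simpa using hx
  obtain ⟨a, ha⟩ : ∃ a : Y ⟶ Y, a ≫ i' = i ≫ f :=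
    ⟨h'.fIsKernel.lift (KernelFork.ofι (i ≫ f) (by simp [hf, w])),
      h'.fIsKernel.fac _ WalkingParallelPair.zero⟩
  have h₁ := extClass_comp_mk₀ h h' a f (𝟙 X) ha (by simp [hf])
  rw [Ext.mk₀_id_comp, ← he] at h₁
  -- The map `a` induced by `f` on `Y` need not be the identity, but pushing out along `a - 𝟙 Y`
  -- kills the class. Hence `a - 𝟙 Y` extends to `b : Z ⟶ Y`, and `f - b ≫ i'` is the corrected map.
  have h₂ : h.extClass.comp (Ext.mk₀ (a - 𝟙 Y)) (add_zero 1) = 0 := by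
    rw [sub_eq_add_neg, Ext.mk₀_add, Ext.mk₀_neg, Ext.comp_add, Ext.comp_neg, h₁,
      Ext.comp_mk₀_id, add_neg_cancel]
  obtain ⟨y, hy⟩ := Ext.contravariant_sequence_exact₁ h Y _ (add_zero 1) h₂
  obtain ⟨b, rfl⟩ := (Ext.mk₀_bijective _ _).2 y
  have hb : i ≫ b = a - 𝟙 Y := by
    apply (Ext.mk₀_bijective _ _).1
    simpa using hy
  have e₁ : i ≫ (f - b ≫ i') = i' := by
    rw [Preadditive.comp_sub, ← Category.assoc, hb, Preadditive.sub_comp, ha]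
    simp
  have e₂ : (f - b ≫ i') ≫ p' = p := by
    simp [Preadditive.sub_comp, hf, w']
  have := ShortComplex.isIso₂_of_shortExact_of_isIso₁₃
    (S₁ := ShortComplex.mk i p w) (S₂ := ShortComplex.mk i' p' w')
    { τ₁ := 𝟙 Y, τ₂ := f - b ≫ i', τ₃ := 𝟙 X, comm₁₂ := by simp [e₁]
      comm₂₃ := by simp [e₂] } h h'
  exact ⟨@asIso _ _ _ _ (f - b ≫ i') this, e₁, e₂⟩

/-- The pullback of a short exact sequence along `m`. -/
lemma shortExact_pullback {Y Z X M : C} {i : Y ⟶ Z} {p : Z ⟶ X} {w : i ≫ p = 0}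
    (h : (ShortComplex.mk i p w).ShortExact) (m : M ⟶ X) :
    (ShortComplex.mk (pullback.lift i (0 : Y ⟶ M) (by simp [w])) (pullback.snd p m)
      (pullback.lift_snd _ _ _)).ShortExact := by
  have : Mono i := h.mono_f
  have : Epi p := h.epi_g
  have hm : Mono (pullback.lift i (0 : Y ⟶ M) (by simp [w] : i ≫ p = 0 ≫ m)) :=
    mono_of_mono_fac (pullback.lift_fst _ _ _)
  refine ShortComplex.ShortExact.mk' ?_ hm inferInstance
  refine ShortComplex.exact_of_f_is_kernel _ (KernelFork.IsLimit.ofι' _ _ fun {W} k hk => ?_)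
  refine ⟨h.fIsKernel.lift (KernelFork.ofι (k ≫ pullback.fst p m) ?_), ?_⟩
  · dsimp only at k hk
    rw [Category.assoc, pullback.condition, reassoc_of% hk, zero_comp]
  · dsimp only at k hk ⊢
    apply pullback.hom_ext
    · rw [Category.assoc, pullback.lift_fst]
      exact h.fIsKernel.fac _ WalkingParallelPair.zero
    · rw [Category.assoc, pullback.lift_snd, comp_zero, hk]

/-- The pushout of a short exact sequence along `q`. -/
lemma shortExact_pushout {Y Z X N : C} {i : Y ⟶ Z} {p : Z ⟶ X} {w : i ≫ p = 0}
    (h : (ShortComplex.mk i p w).ShortExact) (q : Y ⟶ N) :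
    (ShortComplex.mk (pushout.inr i q) (pushout.desc p (0 : N ⟶ X) (by simp [w]))
      (pushout.inr_desc _ _ _)).ShortExact := by
  have : Mono i := h.mono_f
  have : Epi p := h.epi_g
  have hm : Epi (pushout.desc p (0 : N ⟶ X) (by simp [w] : i ≫ p = q ≫ 0)) :=
    epi_of_epi_fac (pushout.inl_desc _ _ _)
  refine ShortComplex.ShortExact.mk' ?_ inferInstance hm
  refine ShortComplex.exact_of_g_is_cokernel _ (CokernelCofork.IsColimit.ofπ' _ _ fun {W} k hk => ?_)
  refine ⟨h.gIsCokernel.desc (CokernelCofork.ofπ (pushout.inl i q ≫ k) ?_), ?_⟩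
  · dsimp only at k hk ⊢
    rw [pushout.condition_assoc, hk, comp_zero]
  · dsimp only at k hk ⊢
    apply pushout.hom_ext
    · rw [pushout.inl_desc_assoc]
      exact h.gIsCokernel.fac _ WalkingParallelPair.one
    · rw [pushout.inr_desc_assoc, zero_comp, hk]

/-- Every extension class is killed by some epimorphism. -/
lemma exists_epi_comp_eq_zero {X Y : C} (e : Ext X Y 1) :
    ∃ (Z : C) (p : Z ⟶ X), Epi p ∧ (Ext.mk₀ p).comp e (zero_add 1) = 0 := by
  let := HasDerivedCategory.standard C
  let T := DerivedCategory.TStructure.t (C := C)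
  -- The class is a map `X ⟶ Y⟦1⟧` in the derived category. The middle object of its triangle is an
  -- extension of objects of the heart, hence in the heart.
  obtain ⟨Z, f, g, hT⟩ := Pretriangulated.distinguished_cocone_triangle₂ e.hom
  have h1 : T.IsGE (((DerivedCategory.singleFunctor C 0).obj X)) 0 := inferInstance
  have h2 : T.IsLE (((DerivedCategory.singleFunctor C 0).obj X)) 0 := inferInstance
  have h3 : T.IsGE (((DerivedCategory.singleFunctor C 0).obj Y)) 0 := inferInstance
  have h4 : T.IsLE (((DerivedCategory.singleFunctor C 0).obj Y)) 0 := inferInstance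
  have h5 : T.IsGE Z 0 := T.isGE₂ _ hT 0 h3 h1
  have h6 : T.IsLE Z 0 := T.isLE₂ _ hT 0 h4 h2
  obtain ⟨Z', ⟨φ⟩⟩ := DerivedCategory.exists_iso_singleFunctor_obj_of_isGE_of_isLE Z 0
  obtain ⟨p, hp⟩ := (DerivedCategory.singleFunctor C 0).map_surjective (φ.inv ≫ g)
  refine ⟨Z', p, ?_, ?_⟩
  -- A map to `Q` killed by `p` factors through `Y⟦1⟧`, which sits in degree `-1` and has no nonzero
  -- map to `Q` in degree `0`.
  · refine Preadditive.epi_of_cancel_zero _ fun {Q} q hq => ?_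
    apply (DerivedCategory.singleFunctor C 0).map_injective
    obtain ⟨r, hr⟩ := Pretriangulated.Triangle.yoneda_exact₃ _ hT
      ((DerivedCategory.singleFunctor C 0).map q) (by
        have := congr_arg (DerivedCategory.singleFunctor C 0).map hq
        rw [Functor.map_comp, hp, Category.assoc, Functor.map_zero] at this
        exact (cancel_epi φ.inv).1 (this.trans comp_zero.symm))
    have h7 : T.IsLE (((DerivedCategory.singleFunctor C 0).obj Y)⟦(1 : ℤ)⟧) (-1) :=
      T.isLE_shift _ 0 1 (-1)
    have h8 : T.IsGE (((DerivedCategory.singleFunctor C 0).obj Q)) 0 := inferInstance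
    rw [hr, @Triangulated.TStructure.zero _ _ _ _ _ _ _ T _ _ r (-1) 0 (by lia) h7 h8]
    refine comp_zero.trans ?_
    exact ((DerivedCategory.singleFunctor C 0).map_zero _ _).symm
  · ext
    rw [Ext.comp_hom, Ext.mk₀_hom, ShiftedHom.mk₀_comp, hp, Category.assoc, Ext.zero_hom]
    erw [Pretriangulated.comp_distTriang_mor_zero₂₃ _ hT]
    exact comp_zero

/-- Every class in `Ext¹` comes from a short exact sequence. -/
lemma exists_extClass_eq {X Y : C} (e : Ext X Y 1) :
    ∃ (Z : C) (i : Y ⟶ Z) (p : Z ⟶ X) (w : i ≫ p = 0)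
      (h : (ShortComplex.mk i p w).ShortExact), h.extClass = e := by
  obtain ⟨Z, p, hp, hpe⟩ := exists_epi_comp_eq_zero e
  have h : (ShortComplex.mk (kernel.ι p) p (kernel.condition p)).ShortExact :=
    { exact := ShortComplex.exact_kernel p }
  -- As `e` dies on `Z`, it is the pushout of `ker p ⟶ Z ⟶ X` along some `a : ker p ⟶ Y`.
  obtain ⟨x, hx⟩ := Ext.contravariant_sequence_exact₃ h Y e hpe (add_zero 1)
  obtain ⟨a, rfl⟩ := (Ext.mk₀_bijective _ _).2 x
  refine ⟨_, _, _, _, shortExact_pushout h a, ?_⟩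
  rw [← hx]
  have := extClass_comp_mk₀ h (shortExact_pushout h a) a (pushout.inl _ _) (𝟙 X)
    pushout.condition.symm ((pushout.inl_desc _ _ _).trans (Category.comp_id p).symm)
  simpa using this.symm

end YonedaExt

/-! ### Orders of groups in exact sequences -/

section GroupCounting

lemma card_range_mul_card_ker {G H : Type*} [AddGroup G] [AddGroup H] (f : G →+ H) :
    Nat.card f.range * Nat.card f.ker = Nat.card G := by
  rw [← AddSubgroup.index_ker, mul_comm, AddSubgroup.card_mul_index]

/-- Each fibre is a coset of the kernel. The product form avoids division. -/
lemma card_preimage_mul_card {G H : Type*} [AddGroup G] [AddGroup H]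
    {f : G →+ H} (hf : Function.Surjective f) (T : Set H) :
    Nat.card (f ⁻¹' T) * Nat.card H = Nat.card T * Nat.card G := by
  have e : (f ⁻¹' T) ≃ T × f.ker :=
    calc (f ⁻¹' T) ≃ Σ y : T, {x : f ⁻¹' T // (⟨f x, x.2⟩ : T) = y} :=
          (Equiv.sigmaFiberEquiv _).symm
      _ ≃ Σ _ : T, f.ker := Equiv.sigmaCongrRight fun y =>
          ({ toFun := fun x => ⟨x.1.1, congr_arg Subtype.val x.2⟩
             invFun := fun x => ⟨⟨x.1, Set.mem_preimage.2 (Set.mem_of_eq_of_mem x.2 y.2)⟩, Subtype.ext x.2⟩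
             left_inv := fun _ => rfl
             right_inv := fun _ => rfl } : _ ≃ (f ⁻¹' {(y : H)})).trans
          (f.fiberEquivKerOfSurjective hf y)
      _ ≃ T × f.ker := Equiv.sigmaEquivProd _ _
  have h := card_range_mul_card_ker f
  rw [AddMonoidHom.range_eq_top.2 hf, AddSubgroup.card_top] at h
  rw [Nat.card_congr e, Nat.card_prod, mul_assoc, mul_comm (Nat.card f.ker), h]

/-- The alternating product of the orders of the groups in a six term exact sequence is `1`. -/
lemma card_mul_of_exact {G₁ G₂ G₃ H₁ H₂ H₃ : Type*} [AddCommGroup G₁] [AddCommGroup G₂]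
    [AddCommGroup G₃] [AddCommGroup H₁] [AddCommGroup H₂] [AddCommGroup H₃]
    {f₁ : G₁ →+ G₂} {f₂ : G₂ →+ G₃} {f₃ : G₃ →+ H₁} {f₄ : H₁ →+ H₂} {f₅ : H₂ →+ H₃}
    (h₁ : Function.Injective f₁) (h₂ : Function.Exact f₁ f₂) (h₃ : Function.Exact f₂ f₃)
    (h₄ : Function.Exact f₃ f₄) (h₅ : Function.Exact f₄ f₅) (h₆ : Function.Surjective f₅) :
    Nat.card G₂ * (Nat.card H₁ * Nat.card H₃) =
      Nat.card G₁ * Nat.card G₃ * Nat.card H₂ := by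
  have k₁ := card_range_mul_card_ker f₁
  have k₂ := card_range_mul_card_ker f₂
  have k₃ := card_range_mul_card_ker f₃
  have k₄ := card_range_mul_card_ker f₄
  have k₅ := card_range_mul_card_ker f₅
  rw [(AddMonoidHom.ker_eq_bot_iff f₁).2 h₁, AddSubgroup.card_bot] at k₁
  rw [AddMonoidHom.exact_iff.1 h₂] at k₂
  rw [AddMonoidHom.exact_iff.1 h₃] at k₃
  rw [AddMonoidHom.exact_iff.1 h₄] at k₄
  rw [AddMonoidHom.exact_iff.1 h₅, AddMonoidHom.range_eq_top.2 h₆, AddSubgroup.card_top] at k₅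
  rw [← k₂, ← k₁, ← k₃, ← k₄, ← k₅]
  ring

end GroupCounting

/-! ### Multiplicativity of the Euler form -/

section Euler

variable {C : Type u} [Category.{v} C] [Abelian C]

lemma natCast_card_ne_zero (G : Type*) [Nonempty G] [Finite G] : (Nat.card G : ℚ) ≠ 0 :=
  Nat.cast_ne_zero.2 Nat.card_pos.ne'

lemma card_ext_zero (X Y : C) : Nat.card (Ext X Y 0) = Nat.card (X ⟶ Y) :=
  Nat.card_congr Ext.homEquiv₀

/-- The long exact sequence stops after six terms because `Ext²` vanishes. -/
lemma eulerForm_mul_left (hExt : ∀ X Y : C, Finite (Ext X Y 1))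
    (hHer : ∀ X Y : C, Subsingleton (Ext X Y 2)) (W : C)
    {Y Z X : C} {i : Y ⟶ Z} {p : Z ⟶ X} {w : i ≫ p = 0}
    (h : (ShortComplex.mk i p w).ShortExact) :
    eulerForm W Z = eulerForm W Y * eulerForm W X := by
  have : Mono i := h.mono_f
  have key := card_mul_of_exact (Ext.postcomp_mk₀_injective_of_mono W i)
    ((ShortComplex.ab_exact_iff_function_exact _).1 (Ext.covariant_sequence_exact₂' W h 0))
    ((ShortComplex.ab_exact_iff_function_exact _).1
      (Ext.covariant_sequence_exact₃' W h 0 1 (zero_add 1)))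
    ((ShortComplex.ab_exact_iff_function_exact _).1
      (Ext.covariant_sequence_exact₁' W h 0 1 (zero_add 1)))
    ((ShortComplex.ab_exact_iff_function_exact _).1 (Ext.covariant_sequence_exact₂' W h 1))
    (fun x => Ext.covariant_sequence_exact₃ W h x (by norm_num : 1 + 1 = 2)
      ((hHer _ _).elim _ _))
  have key' : Nat.card (W ⟶ Z) * (Nat.card (Ext W Y 1) * Nat.card (Ext W X 1)) =
      Nat.card (W ⟶ Y) * Nat.card (W ⟶ X) * Nat.card (Ext W Z 1) := by
    simpa only [card_ext_zero] using key
  have a := natCast_card_ne_zero (Ext W Y 1)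
  have b := natCast_card_ne_zero (Ext W X 1)
  have c := natCast_card_ne_zero (Ext W Z 1)
  unfold eulerForm
  field_simp
  norm_cast
  linarith [key']

lemma eulerForm_mul_right (hExt : ∀ X Y : C, Finite (Ext X Y 1))
    (hHer : ∀ X Y : C, Subsingleton (Ext X Y 2)) (W : C)
    {Y Z X : C} {i : Y ⟶ Z} {p : Z ⟶ X} {w : i ≫ p = 0}
    (h : (ShortComplex.mk i p w).ShortExact) :
    eulerForm Z W = eulerForm Y W * eulerForm X W := by
  have : Epi p := h.epi_g
  have key := card_mul_of_exact (Ext.precomp_mk₀_injective_of_epi W p)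
    ((ShortComplex.ab_exact_iff_function_exact _).1 (Ext.contravariant_sequence_exact₂' h W 0))
    ((ShortComplex.ab_exact_iff_function_exact _).1
      (Ext.contravariant_sequence_exact₁' h W 0 1 (add_zero 1)))
    ((ShortComplex.ab_exact_iff_function_exact _).1
      (Ext.contravariant_sequence_exact₃' h W 0 1 (add_zero 1)))
    ((ShortComplex.ab_exact_iff_function_exact _).1 (Ext.contravariant_sequence_exact₂' h W 1))
    (fun x => Ext.contravariant_sequence_exact₁ h W x (by norm_num : 1 + 1 = 2)
      ((hHer _ _).elim _ _))
  have key' : Nat.card (Z ⟶ W) * (Nat.card (Ext X W 1) * Nat.card (Ext Y W 1)) =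
      Nat.card (X ⟶ W) * Nat.card (Y ⟶ W) * Nat.card (Ext Z W 1) := by
    simpa only [card_ext_zero] using key
  have a := natCast_card_ne_zero (Ext X W 1)
  have b := natCast_card_ne_zero (Ext Y W 1)
  have c := natCast_card_ne_zero (Ext Z W 1)
  unfold eulerForm
  field_simp
  norm_cast
  linarith [key']

end Euler

/-! ### Functoriality of `Ext¹` in both variables -/

section Transfer

variable {C : Type u} [Category.{v} C] [Abelian C]

/-- The map `Ext¹(X, Y) → Ext¹(M, N)` induced by `m : M ⟶ X` and `q : Y ⟶ N`. -/
noncomputable def extTransfer {X Y M N : C} (m : M ⟶ X) (q : Y ⟶ N) : Ext X Y 1 →+ Ext M N 1 :=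
  ((Ext.mk₀ q).postcomp M (add_zero 1)).comp ((Ext.mk₀ m).precomp Y (zero_add 1))

lemma extTransfer_apply {X Y M N : C} (m : M ⟶ X) (q : Y ⟶ N) (e : Ext X Y 1) :
    extTransfer m q e =
      ((Ext.mk₀ m).comp e (zero_add 1)).comp (Ext.mk₀ q) (add_zero 1) := rfl

lemma extTransfer_extTransfer {X Y M N M' N' : C} (m : M ⟶ X) (q : Y ⟶ N) (m' : M' ⟶ M)
    (q' : N ⟶ N') (e : Ext X Y 1) :
    extTransfer m' q' (extTransfer m q e) = extTransfer (m' ≫ m) (q ≫ q') e := by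
  simp only [extTransfer_apply, ← Ext.mk₀_comp_mk₀, Ext.comp_assoc_of_third_deg_zero,
    Ext.comp_assoc_of_second_deg_zero]

/-- Lifting along `q` is obstructed in `Ext²(M, ker q)`, then lifting along `m` in `Ext²(coker m,
Y)`; both vanish. -/
lemma extTransfer_surjective (hHer : ∀ X Y : C, Subsingleton (Ext X Y 2))
    {X Y M N : C} (m : M ⟶ X) (q : Y ⟶ N) [Mono m] [Epi q] :
    Function.Surjective (extTransfer m q) := by
  have hm : (ShortComplex.mk m (cokernel.π m) (cokernel.condition m)).ShortExact :=
    { exact := ShortComplex.exact_cokernel m }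
  have hq : (ShortComplex.mk (kernel.ι q) q (kernel.condition q)).ShortExact :=
    { exact := ShortComplex.exact_kernel q }
  intro e
  obtain ⟨x, hx⟩ := Ext.covariant_sequence_exact₃ M hq e (by norm_num : 1 + 1 = 2)
    ((hHer _ _).elim _ _)
  obtain ⟨y, hy⟩ := Ext.contravariant_sequence_exact₁ hm Y x (by norm_num : 1 + 1 = 2)
    ((hHer _ _).elim _ _)
  exact ⟨y, by rw [extTransfer_apply, ← hx, ← hy]⟩

lemma extTransfer_mem_of_iso {M N M' N' X : C} (a : M' ≅ M) (b : N ≅ N') {e : Ext M N 1}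
    (he : e ∈ extWithMiddle M N X) : extTransfer a.hom b.hom e ∈ extWithMiddle M' N' X := by
  obtain ⟨i, p, w, h, rfl⟩ := he
  have h' : (ShortComplex.mk (b.inv ≫ i) (p ≫ a.inv) (by simp [reassoc_of% w])).ShortExact :=
    ShortComplex.shortExact_of_iso (ShortComplex.isoMk (S₁ := ShortComplex.mk i p w) b (Iso.refl _) a.symm
      (by simp) (by simp)) h
  refine ⟨_, _, _, h', ?_⟩
  have := extClass_comp_mk₀ h h' b.hom (𝟙 X) a.inv (by simp) (by simp)
  rw [extTransfer_apply, Ext.comp_assoc_of_third_deg_zero, this, Ext.mk₀_comp_mk₀_assoc]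
  simp

/-- A class determines its middle term up to isomorphism, so any representing sequence decides
membership. -/
lemma mem_extWithMiddle_iff {M N X Z : C} {i : N ⟶ Z} {p : Z ⟶ M} {w : i ≫ p = 0}
    (h : (ShortComplex.mk i p w).ShortExact) :
    h.extClass ∈ extWithMiddle M N X ↔ Nonempty (Z ≅ X) := by
  constructor
  · rintro ⟨i', p', w', h', he⟩
    obtain ⟨e, -⟩ := exists_iso_of_extClass_eq h h' he.symm
    exact ⟨e⟩
  · rintro ⟨e⟩
    have h' : (ShortComplex.mk (i ≫ e.hom) (e.inv ≫ p) (by simp [w])).ShortExact :=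
      ShortComplex.shortExact_of_iso (ShortComplex.isoMk (S₁ := ShortComplex.mk i p w) (Iso.refl _) e (Iso.refl _)
        (by simp) (by simp)) h
    exact ⟨_, _, _, h', (extClass_eq_of_hom h h' e.hom rfl (by simp)).symm⟩

end Transfer

/-! ### Counting isomorphisms and fibres -/

section Counting

lemma card_iso {C : Type u} [Category.{v} C] {X Y Z W : C}
    (h : Nonempty (X ≅ Z)) (h' : Nonempty (Y ≅ Z)) (hW : W = Z) :
    Nat.card (X ≅ Y) = autCard W := by
  subst hW
  obtain ⟨e⟩ := h
  obtain ⟨e'⟩ := h'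
  exact Nat.card_congr (Iso.isoCongr e e')

lemma card_sigma_of_card_eq {α : Type*} {β : α → Type*} {n : ℕ} [∀ a, Finite (β a)]
    (h : ∀ a, Nat.card (β a) = n) :
    Nat.card (Σ a, β a) = Nat.card α * n := by
  have e : ∀ a, β a ≃ Fin n := fun a => (Finite.equivFin (β a)).trans (finCongr (h a))
  rw [Nat.card_congr (Equiv.sigmaCongrRight e), Nat.card_congr (Equiv.sigmaEquivProd _ _),
    Nat.card_prod, Nat.card_fin]

instance finite_iso {C : Type u} [Category.{v} C] (X Y : C) [Finite (X ⟶ Y)] : Finite (X ≅ Y) :=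
  Finite.of_injective (fun e => e.hom) fun _ _ h => Iso.ext h

end Counting

/-! ### Hall numbers, short exact sequences and morphisms -/

section Subobjects

variable {C : Type u} [Category.{v} C] [Abelian C]

lemma subobject_le_of_comp_eq_zero {Z : C} {L K : Subobject Z}
    (h : L.arrow ≫ cokernel.π K.arrow = 0) : L ≤ K :=
  Subobject.le_of_comm (Abelian.monoLift K.arrow L.arrow h) (Abelian.monoLift_comp _ _ h)

/-- The cokernel of the subobject given by a short exact sequence. -/
lemma exists_cokernel_arrow_iso {Y Z X : C} {i : Y ⟶ Z} [Mono i] {p : Z ⟶ X} {w : i ≫ p = 0}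
    (h : (ShortComplex.mk i p w).ShortExact) :
    ∃ β : cokernel (Subobject.mk i).arrow ≅ X, cokernel.π (Subobject.mk i).arrow ≫ β.hom = p := by
  have hw : (Subobject.mk i).arrow ≫ p = 0 := by
    rw [← Subobject.underlyingIso_hom_comp_eq_mk, Category.assoc, w, comp_zero]
  have h' : (ShortComplex.mk (Subobject.mk i).arrow p hw).ShortExact :=
    ShortComplex.shortExact_of_iso (ShortComplex.isoMk (S₁ := ShortComplex.mk i p w)
      (Subobject.underlyingIso i).symm (Iso.refl _) (Iso.refl _) (by simp) (by simp)) h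
  exact ⟨(cokernelIsCokernel _).coconePointUniqueUpToIso h'.gIsCokernel,
    (cokernelIsCokernel _).comp_coconePointUniqueUpToIso_hom h'.gIsCokernel
      WalkingParallelPair.one⟩

lemma shortExact_of_subobject {Y Z X : C} (L : Subobject Z) (α : Y ≅ (L : C))
    (β : cokernel L.arrow ≅ X) :
    (ShortComplex.mk (α.hom ≫ L.arrow) (cokernel.π L.arrow ≫ β.hom) (by simp)).ShortExact := by
  have h : (ShortComplex.mk L.arrow (cokernel.π L.arrow) (cokernel.condition _)).ShortExact :=
    { exact := ShortComplex.exact_cokernel _ }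
  exact ShortComplex.shortExact_of_iso (ShortComplex.isoMk
    (S₁ := ShortComplex.mk L.arrow (cokernel.π L.arrow) (cokernel.condition _))
    α.symm (Iso.refl _) β (by simp) (by simp)) h

lemma shortExact_kernel_image {A B : C} (f : A ⟶ B) :
    (ShortComplex.mk (kernel.ι f) (factorThruImage f)
      (by rw [← cancel_mono (Limits.image.ι f)]; simp)).ShortExact := by
  refine ShortComplex.ShortExact.mk' (ShortComplex.exact_of_f_is_kernel _
    (isKernelOfComp (Limits.image.ι f) _ (kernelIsKernel f) _ (image.fac f))) ?_ ?_ <;>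
  dsimp only <;> infer_instance

lemma shortExact_image_cokernel {A B : C} (f : A ⟶ B) :
    (ShortComplex.mk (Limits.image.ι f) (cokernel.π f)
      (by rw [← cancel_epi (factorThruImage f)]; simp)).ShortExact := by
  refine ShortComplex.ShortExact.mk' (ShortComplex.exact_of_g_is_cokernel _
    (isCokernelOfComp (factorThruImage f) _ (cokernelIsCokernel f) _ (image.fac f))) ?_ ?_ <;>
  dsimp only <;> infer_instance

/-- The short exact sequences `0 ⟶ Y ⟶ Z ⟶ X ⟶ 0` on given objects. -/
def ShortExactPair (X Y Z : C) : Type v :=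
  {f : (Y ⟶ Z) × (Z ⟶ X) // ∃ w : f.1 ≫ f.2 = 0, (ShortComplex.mk f.1 f.2 w).ShortExact}

variable (hHom : ∀ X Y : C, Finite (X ⟶ Y))
include hHom

/-- A sequence amounts to a subobject `L` of `Z` with isomorphisms `Y ≅ L` and `Z / L ≅ X`, which
are torsors under `Aut Y` and `Aut X`. -/
lemma card_shortExactPair (X Y Z : C) :
    Nat.card (ShortExactPair X Y Z) = hallNumber X Y Z * autCard Y * autCard X := by
  let T := Σ L : {L : Subobject Z // Nonempty ((L : C) ≅ Y) ∧ Nonempty (cokernel L.arrow ≅ X)},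
    (Y ≅ (L.1 : C)) × (cokernel L.1.arrow ≅ X)
  let F : T → ShortExactPair X Y Z := fun x =>
    ⟨(x.2.1.hom ≫ x.1.1.arrow, cokernel.π x.1.1.arrow ≫ x.2.2.hom), _,
      shortExact_of_subobject x.1.1 x.2.1 x.2.2⟩
  have hF : Function.Bijective F := by
    constructor
    · rintro ⟨⟨L, hL⟩, α, β⟩ ⟨⟨L', hL'⟩, α', β'⟩ h
      have h₁ : α.hom ≫ L.arrow = α'.hom ≫ L'.arrow := congr_arg (fun x => x.1.1) h
      have h₂ : cokernel.π L.arrow ≫ β.hom = cokernel.π L'.arrow ≫ β'.hom :=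
        congr_arg (fun x => x.1.2) h
      obtain rfl : L = L' := Subobject.eq_of_comm (α.symm ≪≫ α') (by simp [← h₁])
      obtain rfl : α = α' := Iso.ext ((cancel_mono _).1 h₁)
      obtain rfl : β = β' := Iso.ext ((cancel_epi _).1 h₂)
      rfl
    · rintro ⟨⟨i, p⟩, w, h⟩
      have : Mono i := h.mono_f
      obtain ⟨β, hβ⟩ := exists_cokernel_arrow_iso h
      exact ⟨⟨⟨Subobject.mk i, ⟨Subobject.underlyingIso i⟩, ⟨β⟩⟩,
        (Subobject.underlyingIso i).symm, β⟩, Subtype.ext (Prod.ext (by simp [F]) hβ)⟩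
  rw [← Nat.card_congr (Equiv.ofBijective F hF), mul_assoc]
  refine card_sigma_of_card_eq fun L => ?_
  rw [Nat.card_prod, card_iso ⟨Iso.refl Y⟩ L.2.1 rfl, card_iso L.2.2 ⟨Iso.refl X⟩ rfl]

/-- The number of morphisms with given kernel, image and cokernel. -/
lemma card_hom_kernel_image_cokernel (A B M S N : C) :
    Nat.card {f : A ⟶ B // Nonempty (kernel f ≅ M) ∧ Nonempty (image f ≅ S) ∧
      Nonempty (cokernel f ≅ N)} =
      hallNumber S M A * hallNumber N S B * autCard S := by
  -- A morphism is encoded by its kernel `L`, its image `K` and the isomorphism `A / L ≅ K`.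
  let T := Σ LK : {L : Subobject A // Nonempty ((L : C) ≅ M) ∧ Nonempty (cokernel L.arrow ≅ S)} ×
    {K : Subobject B // Nonempty ((K : C) ≅ S) ∧ Nonempty (cokernel K.arrow ≅ N)},
    (cokernel LK.1.1.arrow ≅ (LK.2.1 : C))
  let G : T → (A ⟶ B) := fun x => cokernel.π x.1.1.1.arrow ≫ x.2.hom ≫ x.1.2.1.arrow
  have hG : ∀ x, Nonempty (kernel (G x) ≅ M) ∧ Nonempty (image (G x) ≅ S) ∧
      Nonempty (cokernel (G x) ≅ N) := by
    rintro ⟨⟨⟨L, ⟨a⟩, ⟨b⟩⟩, ⟨K, ⟨c⟩, ⟨d⟩⟩⟩, β⟩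
    refine ⟨⟨?_⟩, ⟨?_⟩, ⟨?_⟩⟩
    · have h : (ShortComplex.mk L.arrow (cokernel.π L.arrow) (cokernel.condition _)).ShortExact :=
        { exact := ShortComplex.exact_cokernel _ }
      exact kernelCompMono (cokernel.π L.arrow) (β.hom ≫ K.arrow) ≪≫
        (kernelIsKernel _).conePointUniqueUpToIso h.fIsKernel ≪≫ a
    · exact (image.isoStrongEpiMono (cokernel.π L.arrow ≫ β.hom) K.arrow
        (by simp [G])).symm ≪≫ c
    · exact cokernelEpiComp (cokernel.π L.arrow) (β.hom ≫ K.arrow) ≪≫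
        cokernelEpiComp β.hom K.arrow ≪≫ d
  let F : T → {f : A ⟶ B // Nonempty (kernel f ≅ M) ∧ Nonempty (image f ≅ S) ∧
      Nonempty (cokernel f ≅ N)} := fun x => ⟨G x, hG x⟩
  have hF : Function.Bijective F := by
    constructor
    · have key₁ : ∀ x y, G x = G y → x.1.1.1 ≤ y.1.1.1 := fun x y h => by
        apply subobject_le_of_comp_eq_zero
        rw [← cancel_mono (y.2.hom ≫ y.1.2.1.arrow), Category.assoc, zero_comp]
        exact (congr_arg (x.1.1.1.arrow ≫ ·) h).symm.trans (by simp [G])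
      have key₂ : ∀ x y, G x = G y → x.1.2.1 ≤ y.1.2.1 := fun x y h => by
        apply subobject_le_of_comp_eq_zero
        rw [← cancel_epi (cokernel.π x.1.1.1.arrow ≫ x.2.hom), comp_zero]
        have := congr_arg (· ≫ cokernel.π y.1.2.1.arrow) h
        simpa [G] using this
      intro x y h
      have hxy : G x = G y := congr_arg Subtype.val h
      have e₁ := le_antisymm (key₁ x y hxy) (key₁ y x hxy.symm)
      have e₂ := le_antisymm (key₂ x y hxy) (key₂ y x hxy.symm)
      obtain ⟨⟨⟨L, hL⟩, ⟨K, hK⟩⟩, β⟩ := x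
      obtain ⟨⟨⟨L', hL'⟩, ⟨K', hK'⟩⟩, β'⟩ := y
      dsimp only at e₁ e₂
      subst e₁ e₂
      obtain rfl : β = β' := Iso.ext ((cancel_mono K.arrow).1
        ((cancel_epi (cokernel.π L.arrow)).1 (by simpa [G] using hxy)))
      rfl
    · rintro ⟨f, ⟨a⟩, ⟨b⟩, ⟨c⟩⟩
      obtain ⟨β, hβ⟩ := exists_cokernel_arrow_iso (shortExact_kernel_image f)
      obtain ⟨γ, -⟩ := exists_cokernel_arrow_iso (shortExact_image_cokernel f)
      refine ⟨⟨⟨⟨Subobject.mk (kernel.ι f), ⟨Subobject.underlyingIso _ ≪≫ a⟩, ⟨β ≪≫ b⟩⟩,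
        ⟨Subobject.mk (Limits.image.ι f), ⟨Subobject.underlyingIso _ ≪≫ b⟩, ⟨γ ≪≫ c⟩⟩⟩,
        β ≪≫ (Subobject.underlyingIso _).symm⟩, Subtype.ext ?_⟩
      simp [F, G, reassoc_of% hβ]
  rw [← Nat.card_congr (Equiv.ofBijective F hF)]
  refine (card_sigma_of_card_eq fun LK => ?_).trans
    (congr_arg (· * autCard S) (Nat.card_prod _ _))
  exact card_iso LK.1.2.2 LK.2.2.1 rfl

end Subobjects

/-! ### Riedtmann's formula -/

section Riedtmann

variable {C : Type u} [Category.{v} C] [Abelian C]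

/-- The automorphism `𝟙 + p ≫ h ≫ i` of `Z`, for `h : X ⟶ Y`. -/
def unipotentAut {Y Z X : C} {i : Y ⟶ Z} {p : Z ⟶ X} (w : i ≫ p = 0) (h : X ⟶ Y) : Z ≅ Z where
  hom := 𝟙 Z + p ≫ h ≫ i
  inv := 𝟙 Z - p ≫ h ≫ i
  hom_inv_id := by simp [reassoc_of% w]
  inv_hom_id := by simp [reassoc_of% w]

/-- `φ - 𝟙` vanishes on `Y` and lands in `Y`, so it factors through a map `X ⟶ Y`: the stabiliser of
a sequence is `Hom(X, Y)`. -/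
lemma exists_eq_unipotentAut {Y Z X : C} {i : Y ⟶ Z} {p : Z ⟶ X} {w : i ≫ p = 0}
    (h : (ShortComplex.mk i p w).ShortExact) {φ : Z ≅ Z} (hi : i ≫ φ.hom = i)
    (hp : φ.hom ≫ p = p) : ∃ k : X ⟶ Y, φ = unipotentAut w k := by
  have : Mono i := h.mono_f
  have : Epi p := h.epi_g
  obtain ⟨l, hl⟩ : ∃ l, p ≫ l = φ.hom - 𝟙 Z :=
    ⟨h.gIsCokernel.desc (CokernelCofork.ofπ (φ.hom - 𝟙 Z) (by simp [hi])),
      h.gIsCokernel.fac _ WalkingParallelPair.one⟩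
  have hlp : l ≫ p = 0 := by
    rw [← cancel_epi p, reassoc_of% hl]
    simp [hp]
  obtain ⟨k, hk⟩ : ∃ k, k ≫ i = l :=
    ⟨h.fIsKernel.lift (KernelFork.ofι l hlp), h.fIsKernel.fac _ WalkingParallelPair.zero⟩
  exact ⟨k, Iso.ext (by simp [unipotentAut, hk, hl])⟩

/-- Riedtmann's formula. -/
lemma card_extWithMiddle_mul_autCard (hHom : ∀ X Y : C, Finite (X ⟶ Y)) (X Y Z : C) :
    Nat.card (extWithMiddle X Y Z) * autCard Z =
      hallNumber X Y Z * autCard Y * autCard X * Nat.card (X ⟶ Y) := by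
  rw [← card_shortExactPair hHom]
  let cl : ShortExactPair X Y Z → extWithMiddle X Y Z := fun x =>
    ⟨x.2.choose_spec.extClass, x.1.1, x.1.2, _, _, rfl⟩
  have hcl : Function.Surjective cl := by
    rintro ⟨e, i, p, w, h, rfl⟩
    exact ⟨⟨(i, p), w, h⟩, rfl⟩
  choose s hs using hcl
  have hiso : ∀ x, ∃ φ : Z ≅ Z, (s (cl x)).1.1 ≫ φ.hom = x.1.1 ∧ φ.hom ≫ x.1.2 = (s (cl x)).1.2 :=
    fun x => exists_iso_of_extClass_eq (s (cl x)).2.choose_spec x.2.choose_spec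
      (congr_arg Subtype.val (hs (cl x)))
  choose φ hφi hφp using hiso
  -- Orbit-stabiliser as a bijection: `Aut Z` acts on sequences with the classes as orbits. A
  -- sequence `x` and `k : X ⟶ Y` give the class of `x` and an automorphism carrying the chosen
  -- representative `s` to `x`; `k` runs through all such automorphisms.
  let F : ShortExactPair X Y Z × (X ⟶ Y) → extWithMiddle X Y Z × (Z ≅ Z) := fun x =>
    (cl x.1, φ x.1 ≪≫ unipotentAut x.1.2.choose x.2)
  have hFi : ∀ x k, (s (cl x)).1.1 ≫ (φ x ≪≫ unipotentAut x.2.choose k).hom = x.1.1 := by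
    intro x k
    have w := x.2.choose
    simp [unipotentAut, reassoc_of% (hφi x), hφi x, reassoc_of% w]
  have hFp : ∀ x k, (φ x ≪≫ unipotentAut x.2.choose k).hom ≫ x.1.2 = (s (cl x)).1.2 := by
    intro x k
    have w := x.2.choose
    simp [unipotentAut, hφp x, w]
  have hF : Function.Bijective F := by
    constructor
    · rintro ⟨x, k⟩ ⟨x', k'⟩ h
      have h₁ : cl x = cl x' := congr_arg Prod.fst h
      have h₂ : (φ x ≪≫ unipotentAut x.2.choose k) = (φ x' ≪≫ unipotentAut x'.2.choose k') :=
        congr_arg Prod.snd h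
      obtain rfl : x = x' := by
        refine Subtype.ext (Prod.ext ?_ ?_)
        · rw [← hFi x k, ← hFi x' k', h₁, h₂]
        · rw [← cancel_epi (φ x ≪≫ unipotentAut x.2.choose k).hom, hFp, h₂, hFp, h₁]
      have : Mono x.1.1 := x.2.choose_spec.mono_f
      have : Epi x.1.2 := x.2.choose_spec.epi_g
      have h₃ := congr_arg Iso.hom h₂
      simp only [unipotentAut, Iso.trans_hom, cancel_epi, add_right_inj, cancel_mono] at h₃
      rw [h₃]
    · rintro ⟨e, ψ⟩
      obtain ⟨w, h⟩ := (s e).2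
      have h' : (ShortComplex.mk ((s e).1.1 ≫ ψ.hom) (ψ.inv ≫ (s e).1.2)
          (by simp [w])).ShortExact :=
        ShortComplex.shortExact_of_iso (ShortComplex.isoMk (S₁ := ShortComplex.mk _ _ w)
          (Iso.refl _) ψ (Iso.refl _) (by simp) (by simp)) h
      let x : ShortExactPair X Y Z := ⟨(_, _), _, h'⟩
      have hx : cl x = e := by
        rw [← hs e]
        exact Subtype.ext (extClass_eq_of_hom h h' ψ.hom rfl (by simp)).symm
      have hi := hφi x
      have hp := hφp x
      rw [hx] at hi hp
      obtain ⟨k, hk⟩ := exists_eq_unipotentAut h' (φ := (φ x).symm ≪≫ ψ)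
        (by
          have : (s e).1.1 = x.1.1 ≫ (φ x).inv := by rw [← hi]; simp
          change x.1.1 ≫ (φ x).inv ≫ ψ.hom = (s e).1.1 ≫ ψ.hom
          rw [reassoc_of% this])
        (by
          change ((φ x).inv ≫ ψ.hom) ≫ ψ.inv ≫ (s e).1.2 = ψ.inv ≫ (s e).1.2
          have : (φ x).inv ≫ (s e).1.2 = x.1.2 := by rw [← hp, Iso.inv_hom_id_assoc]
          rw [Category.assoc, ψ.hom_inv_id_assoc, this])
      exact ⟨(x, k), Prod.ext hx (by
        change φ x ≪≫ unipotentAut _ k = ψ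
        rw [← hk]; simp)⟩
  have := Nat.card_congr (Equiv.ofBijective F hF)
  rw [Nat.card_prod, Nat.card_prod] at this
  exact this.symm

end Riedtmann

/-! ### Homology as a transferred extension -/

section Homology

variable {C : Type u} [Category.{v} C] [Abelian C]

/-- If the incoming differential of `Z` factors through `α : U ⟶ Y ↪ Z` and the outgoing one
through `Z ↠ X` and `β : X ⟶ V`, the homology at `Z` is an extension of `ker β` by `coker α`, with
class induced from that of `Z`. -/
lemma extTransfer_mem_iff_homology {T : ShortComplex C} {Y X : C} {i : Y ⟶ T.X₂} {p : T.X₂ ⟶ X}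
    {w : i ≫ p = 0} (h : (ShortComplex.mk i p w).ShortExact) {U V : C} (a : T.X₁ ⟶ U) (_ : Epi a)
    (α : U ⟶ Y) (β : X ⟶ V) (b : V ⟶ T.X₃) (_ : Mono b) (hf : T.f = a ≫ α ≫ i)
    (hg : T.g = p ≫ β ≫ b) (H : C) :
    extTransfer (kernel.ι β) (cokernel.π α) h.extClass ∈
      extWithMiddle (kernel β) (cokernel α) H ↔ Nonempty (T.homology ≅ H) := by
  have : Mono i := h.mono_f
  have : Epi p := h.epi_g
  -- The pullback to `ker β` is the object of cycles, as `b` is mono; pushing out along `coker α`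
  -- divides by the boundaries, as `a` is epi.
  let j : Y ⟶ pullback p (kernel.ι β) := pullback.lift i 0 (by simp [w])
  have h₁ : (ShortComplex.mk j (pullback.snd p (kernel.ι β)) _).ShortExact :=
    shortExact_pullback h (kernel.ι β)
  have h₂ := shortExact_pushout h₁ (cokernel.π α)
  have hcl : extTransfer (kernel.ι β) (cokernel.π α) h.extClass = h₂.extClass := by
    have e₁ := extClass_comp_mk₀ h₁ h (𝟙 Y) (pullback.fst p (kernel.ι β)) (kernel.ι β)
      ((Category.id_comp i).trans (pullback.lift_fst i 0 _).symm) pullback.condition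
    have e₂ := extClass_comp_mk₀ h₁ h₂ (cokernel.π α) (pushout.inl _ _) (𝟙 _)
      pushout.condition.symm ((pushout.inl_desc _ _ _).trans (Category.comp_id _).symm)
    rw [Ext.comp_mk₀_id] at e₁
    rw [Ext.mk₀_id_comp] at e₂
    rw [extTransfer_apply, ← e₂]
    exact congr_arg (fun x => Ext.comp x (Ext.mk₀ (cokernel.π α)) (add_zero 1)) e₁.symm
  rw [hcl, mem_extWithMiddle_iff]
  have wi : pullback.fst p (kernel.ι β) ≫ T.g = 0 := by
    rw [hg, pullback.condition_assoc, kernel.condition_assoc, zero_comp, comp_zero]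
  have hi : IsLimit (KernelFork.ofι (pullback.fst p (kernel.ι β)) wi) :=
    KernelFork.IsLimit.ofι' _ _ fun {W} k hk =>
      ⟨pullback.lift k (kernel.lift β (k ≫ p) (by
        rw [← cancel_mono b, zero_comp, Category.assoc, Category.assoc, ← hg, hk])) (by simp),
        pullback.lift_fst _ _ _⟩
  have hlift : hi.lift (KernelFork.ofι _ T.zero) = a ≫ α ≫ j := by
    rw [← cancel_mono (pullback.fst p (kernel.ι β))]
    have hj : j ≫ pullback.fst p (kernel.ι β) = i := pullback.lift_fst _ _ _
    rw [Category.assoc, Category.assoc, hj, ← hf]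
    exact hi.fac _ WalkingParallelPair.zero
  have wπ : hi.lift (KernelFork.ofι _ T.zero) ≫ pushout.inl j (cokernel.π α) = 0 := by
    rw [hlift, Category.assoc, Category.assoc, pushout.condition, cokernel.condition_assoc,
      zero_comp, comp_zero]
  have hπ : IsColimit (CokernelCofork.ofπ (pushout.inl j (cokernel.π α)) wπ) :=
    CokernelCofork.IsColimit.ofπ' _ _ fun {W} k hk =>
      ⟨pushout.desc k (cokernel.desc α (j ≫ k) (by
        rw [← cancel_epi a, comp_zero, ← hk, hlift, Category.assoc, Category.assoc])) (by simp),
        pushout.inl_desc _ _ _⟩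
  let D : T.LeftHomologyData := ⟨_, _, _, _, wi, hi, wπ, hπ⟩
  exact ⟨fun ⟨e⟩ => ⟨D.homologyIso ≪≫ e⟩, fun ⟨e⟩ => ⟨D.homologyIso.symm ≪≫ e⟩⟩

end Homology

/-! ### Extensions of complexes with zero differentials -/

section Complexes

variable {C : Type u} [Category.{v} C] [Abelian C] {t : ℕ} {A₁ A₂ : ZMod t → C}

/-- The degree `i` part of a morphism from a complex with zero differentials. -/
def inclAt {K : PeriodicComplex C t} (ι : zeroDiff A₂ ⟶ K) (i : ZMod t) : A₂ i ⟶ K.X i := ι.f i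

/-- The degree `i` part of a morphism to a complex with zero differentials. -/
def projAt {K : PeriodicComplex C t} (π : K ⟶ zeroDiff A₁) (i : ZMod t) : K.X i ⟶ A₁ i := π.f i

lemma shortExact_eval {K : PeriodicComplex C t} {ι : zeroDiff A₂ ⟶ K} {π : K ⟶ zeroDiff A₁}
    {w : ι ≫ π = 0} (h : (ShortComplex.mk ι π w).ShortExact) (i : ZMod t) :
    (ShortComplex.mk (inclAt ι i) (projAt π i)
      (congr_arg (fun f => HomologicalComplex.Hom.f f i) w)).ShortExact :=
  (HomologicalComplex.shortExact_iff_degreewise_shortExact _).1 h i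

lemma shortExact_of_eval {K : PeriodicComplex C t} {ι : zeroDiff A₂ ⟶ K} {π : K ⟶ zeroDiff A₁}
    {w : ι ≫ π = 0} (h : ∀ i, ∃ w', (ShortComplex.mk 
      (inclAt ι i) (projAt π i) w').ShortExact) : (ShortComplex.mk ι π w).ShortExact :=
  (HomologicalComplex.shortExact_iff_degreewise_shortExact _).2 fun i => (h i).2

/-- The class `e` is that of a short exact sequence of complexes that has class `ξ i` in degree `i`
and whose differentials are `K i ↠ A₁ i ⟶ A₂ (i + 1) ↪ K (i + 1)`, with `δ i` in the middle. -/
def Represents (e : Ext (zeroDiff A₁) (zeroDiff A₂) 1) (ξ : ∀ i, Ext (A₁ i) (A₂ i) 1)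
    (δ : ∀ i, A₁ i ⟶ A₂ (i + 1)) : Prop :=
  ∃ (K : PeriodicComplex C t) (ι : zeroDiff A₂ ⟶ K) (π : K ⟶ zeroDiff A₁) (w : ι ≫ π = 0)
    (h : (ShortComplex.mk ι π w).ShortExact), h.extClass = e ∧
      (∀ i, (shortExact_eval h i).extClass = ξ i) ∧
      ∀ i, K.d i (i + 1) = projAt π i ≫ δ i ≫ inclAt ι (i + 1)

lemma exists_represents (e : Ext (zeroDiff A₁) (zeroDiff A₂) 1) :
    ∃ ξ δ, Represents e ξ δ := by
  obtain ⟨K, ι, π, w, h, rfl⟩ := exists_extClass_eq e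
  have hδ : ∀ i, ∃ δ : A₁ i ⟶ A₂ (i + 1), K.d i (i + 1) = projAt π i ≫ δ ≫ inclAt ι (i + 1) := by
    intro i
    have hi := shortExact_eval h i
    have hj := shortExact_eval h (i + 1)
    have : Epi (projAt π i) := hi.epi_g
    have h₁ : inclAt ι i ≫ K.d i (i + 1) = 0 := (ι.comm i (i + 1)).trans zero_comp
    have h₂ : K.d i (i + 1) ≫ projAt π (i + 1) = 0 := (π.comm i (i + 1)).symm.trans comp_zero
    obtain ⟨k, hk⟩ : ∃ k, projAt π i ≫ k = K.d i (i + 1) :=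
      ⟨hi.gIsCokernel.desc (CokernelCofork.ofπ (K.d i (i + 1)) h₁),
        hi.gIsCokernel.fac _ WalkingParallelPair.one⟩
    have hk' : k ≫ projAt π (i + 1) = 0 := by
      rw [← cancel_epi (projAt π i), reassoc_of% hk, h₂, comp_zero]
    obtain ⟨l, hl⟩ : ∃ l, l ≫ inclAt ι (i + 1) = k :=
      ⟨hj.fIsKernel.lift (KernelFork.ofι k hk'), hj.fIsKernel.fac _ WalkingParallelPair.zero⟩
    exact ⟨l, by rw [← hk, ← hl]⟩
  choose δ hδ using hδ
  exact ⟨_, δ, K, ι, π, w, h, rfl, fun i => rfl, hδ⟩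

/-- The composite of two such differentials contains `ι ≫ π = 0`, so `δ` is unconstrained. -/
lemma represents_surjective (ξ : ∀ i, Ext (A₁ i) (A₂ i) 1) (δ : ∀ i, A₁ i ⟶ A₂ (i + 1)) :
    ∃ e, Represents e ξ δ := by
  choose Z ι π w h hξ using fun i => exists_extClass_eq (ξ i)
  let K : PeriodicComplex C t := CochainComplex.of Z (fun i => π i ≫ δ i ≫ ι (i + 1))
    (fun i => by simp [reassoc_of% (w (i + 1))])
  have hd : ∀ i, K.d i (i + 1) = π i ≫ δ i ≫ ι (i + 1) := fun i =>
    CochainComplex.of_d Z (fun i => π i ≫ δ i ≫ ι (i + 1)) i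
  let ι' : zeroDiff A₂ ⟶ K :=
    { f := ι
      comm' := by
        rintro i _ rfl
        rw [hd]
        change ι i ≫ π i ≫ δ i ≫ ι (i + 1) = (0 : A₂ i ⟶ A₂ (i + 1)) ≫ ι (i + 1)
        rw [reassoc_of% (w i), zero_comp, zero_comp] }
  let π' : K ⟶ zeroDiff A₁ :=
    { f := π
      comm' := by
        rintro i _ rfl
        rw [hd]
        change π i ≫ (0 : A₁ i ⟶ A₁ (i + 1)) = (π i ≫ δ i ≫ ι (i + 1)) ≫ π (i + 1)
        rw [Category.assoc, Category.assoc, w (i + 1), comp_zero, comp_zero, comp_zero] }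
  have w' : ι' ≫ π' = 0 := HomologicalComplex.hom_ext _ _ w
  exact ⟨_, K, ι', π', w', shortExact_of_eval fun i => ⟨w i, h i⟩, rfl, hξ, hd⟩

lemma Represents.unique_right {e : Ext (zeroDiff A₁) (zeroDiff A₂) 1}
    {ξ ξ' : ∀ i, Ext (A₁ i) (A₂ i) 1} {δ δ' : ∀ i, A₁ i ⟶ A₂ (i + 1)}
    (h : Represents e ξ δ) (h' : Represents e ξ' δ') : ξ = ξ' ∧ δ = δ' := by
  obtain ⟨K, ι, π, w, h, rfl, hξ, hδ⟩ := h
  obtain ⟨K', ι', π', w', h', he, hξ', hδ'⟩ := h'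
  obtain ⟨φ, hι, hπ⟩ := exists_iso_of_extClass_eq h h' he.symm
  have hι' : ∀ i, inclAt ι i ≫ φ.hom.f i = inclAt ι' i := fun i => by rw [← hι]; rfl
  have hπ' : ∀ i, φ.hom.f i ≫ projAt π' i = projAt π i := fun i => by rw [← hπ]; rfl
  constructor
  · ext1 i
    rw [← hξ, ← hξ']
    exact extClass_eq_of_hom _ _ (φ.hom.f i) (hι' i) (hπ' i)
  · ext1 i
    have : Epi (projAt π i) := (shortExact_eval h i).epi_g
    have : Mono (inclAt ι' (i + 1)) := (shortExact_eval h' (i + 1)).mono_f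
    rw [← cancel_mono (inclAt ι' (i + 1)), ← cancel_epi (projAt π i)]
    have : φ.hom.f i ≫ K'.d i (i + 1) = K.d i (i + 1) ≫ φ.hom.f (i + 1) := φ.hom.comm _ _
    rw [hδ, hδ', reassoc_of% (hπ' i), Category.assoc, Category.assoc, hι'] at this
    exact this.symm

/-- Degreewise isomorphisms inducing the identity on both ends commute with the differentials,
because these factor through the ends. -/
lemma Represents.unique_left {e e' : Ext (zeroDiff A₁) (zeroDiff A₂) 1}
    {ξ : ∀ i, Ext (A₁ i) (A₂ i) 1} {δ : ∀ i, A₁ i ⟶ A₂ (i + 1)}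
    (h : Represents e ξ δ) (h' : Represents e' ξ δ) : e = e' := by
  obtain ⟨K, ι, π, w, h, rfl, hξ, hδ⟩ := h
  obtain ⟨K', ι', π', w', h', rfl, hξ', hδ'⟩ := h'
  choose φ hι hπ using fun i => exists_iso_of_extClass_eq (shortExact_eval h i)
    (shortExact_eval h' i) ((hξ i).trans (hξ' i).symm)
  let Φ : K ⟶ K' :=
    { f := fun i => (φ i).hom
      comm' := by
        rintro i _ rfl
        rw [hδ, hδ', reassoc_of% (hπ i), Category.assoc, Category.assoc, hι] }
  exact extClass_eq_of_hom h h' Φ (HomologicalComplex.hom_ext _ _ hι)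
    (HomologicalComplex.hom_ext _ _ hπ)

/-- The conditions on the homology and on the images of the differentials of an extension, in terms
of its classes in each degree and its differentials. -/
def Admissible (X S : ZMod t → C) (ξ : ∀ i, Ext (A₁ i) (A₂ i) 1)
    (δ : ∀ i, A₁ i ⟶ A₂ (i + 1)) : Prop :=
  (∀ i, Nonempty (image (δ i) ≅ S (i + 1))) ∧
    ∀ i, extTransfer (kernel.ι (δ (i + 1))) (cokernel.π (δ i)) (ξ (i + 1)) ∈
      extWithMiddle (kernel (δ (i + 1))) (cokernel (δ i)) (X (i + 1))

lemma Represents.mem_extensionClasses_iff {e : Ext (zeroDiff A₁) (zeroDiff A₂) 1}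
    {ξ : ∀ i, Ext (A₁ i) (A₂ i) 1} {δ : ∀ i, A₁ i ⟶ A₂ (i + 1)}
    (h : Represents e ξ δ) (X S : ZMod t → C) :
    e ∈ extensionClasses A₁ A₂ X S ↔ Admissible X S ξ δ := by
  obtain ⟨K, ι, π, w, h, rfl, hξ, hδ⟩ := h
  have him : ∀ i, Nonempty (image (δ i) ≅ image (K.d i (i + 1))) := fun i => by
    have : Epi (projAt π i) := (shortExact_eval h i).epi_g
    have : Mono (inclAt ι (i + 1)) := (shortExact_eval h (i + 1)).mono_f
    have : Epi (projAt π i ≫ factorThruImage (δ i)) := epi_comp _ _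
    have := strongEpi_of_epi (projAt π i ≫ factorThruImage (δ i))
    exact ⟨image.isoStrongEpiMono (projAt π i ≫ factorThruImage (δ i))
      (Limits.image.ι (δ i) ≫ inclAt ι (i + 1)) (by simp [hδ])⟩
  have hH : ∀ i, extTransfer (kernel.ι (δ (i + 1))) (cokernel.π (δ i)) (ξ (i + 1)) ∈
      extWithMiddle (kernel (δ (i + 1))) (cokernel (δ i)) (X (i + 1)) ↔
      Nonempty (K.homology (i + 1) ≅ X (i + 1)) := fun i => by
    have e := K.homologyIsoSc' i (i + 1) (i + 1 + 1) (ComplexShape.prev_eq' _ rfl)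
      (ComplexShape.next_eq' _ rfl)
    rw [← hξ]
    refine (extTransfer_mem_iff_homology (T := K.sc' i (i + 1) (i + 1 + 1))
      (shortExact_eval h (i + 1)) (projAt π i) (shortExact_eval h i).epi_g (δ i) (δ (i + 1))
      (inclAt ι (i + 1 + 1)) (shortExact_eval h (i + 1 + 1)).mono_f (hδ i) (hδ (i + 1)) _).trans ?_
    exact ⟨fun ⟨f⟩ => ⟨e ≪≫ f⟩, fun ⟨f⟩ => ⟨e.symm ≪≫ f⟩⟩
  have key : h.extClass ∈ extensionClasses A₁ A₂ X S ↔ ∃ K' : PeriodicComplex C t,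
      (∀ i, Nonempty (K'.homology i ≅ X i)) ∧
      (∀ i, Nonempty (image (K'.d i (i + 1)) ≅ S (i + 1))) ∧ Nonempty (K ≅ K') := by
    simp only [extensionClasses, Set.mem_iUnion, exists_prop]
    exact exists_congr fun K' => and_congr_right' (and_congr_right' (mem_extWithMiddle_iff h))
  simp only [Admissible, hH, key]
  constructor
  · rintro ⟨K', hX, hS, ⟨φ⟩⟩
    refine ⟨fun i => ?_, fun i => ?_⟩
    · obtain ⟨f⟩ := him i
      obtain ⟨g⟩ := hS i
      have : φ.hom.f i ≫ K'.d i (i + 1) = K.d i (i + 1) ≫ φ.hom.f (i + 1) := φ.hom.comm _ _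
      have hφ : K'.d i (i + 1) = φ.inv.f i ≫ K.d i (i + 1) ≫ φ.hom.f (i + 1) := by
        rw [← this, ← HomologicalComplex.comp_f_assoc, φ.inv_hom_id]
        simp
      exact ⟨f ≪≫ image.isoStrongEpiMono (φ.inv.f i ≫ factorThruImage (K.d i (i + 1)))
        (Limits.image.ι _ ≫ φ.hom.f (i + 1)) (by
          rw [hφ, Category.assoc, Limits.image.fac_assoc]) ≪≫ g⟩
    · obtain ⟨g⟩ := hX (i + 1)
      exact ⟨(HomologicalComplex.homologyMapIso φ (i + 1)) ≪≫ g⟩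
  · rintro ⟨hS, hX⟩
    refine ⟨K, fun i => ?_, fun i => ?_, ⟨Iso.refl _⟩⟩
    -- `Admissible` describes homology in degrees `j + 1`, where `δ j` ends without any transport;
    -- every degree has this form in `ℤ/t`.
    · obtain ⟨j, rfl⟩ : ∃ j, j + 1 = i := ⟨i - 1, sub_add_cancel _ _⟩
      exact hX j
    · obtain ⟨f⟩ := him i
      obtain ⟨g⟩ := hS i
      exact ⟨f.symm ≪≫ g⟩

/-- Extension classes of complexes with zero differentials are given by extension classes in each
degree and arbitrary maps `A₁ i ⟶ A₂ (i + 1)`. -/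
lemma nonempty_extensionClasses_equiv (X S : ZMod t → C) :
    Nonempty (extensionClasses A₁ A₂ X S ≃
      {x : (∀ i, A₁ i ⟶ A₂ (i + 1)) × (∀ i, Ext (A₁ i) (A₂ i) 1) // Admissible X S x.2 x.1}) := by
  choose ξ δ h using exists_represents (A₁ := A₁) (A₂ := A₂)
  refine ⟨Equiv.ofBijective
    (fun e => ⟨(δ e, ξ e), ((h e).mem_extensionClasses_iff X S).1 e.2⟩) ⟨?_, ?_⟩⟩
  · intro e e' hee
    have h₁ : δ e = δ e' := congr_arg (fun x => x.1.1) hee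
    have h₂ : ξ e = ξ e' := congr_arg (fun x => x.1.2) hee
    have := h e
    rw [h₁, h₂] at this
    exact Subtype.ext (this.unique_left (h e'))
  · rintro ⟨⟨δ', ξ'⟩, hx⟩
    obtain ⟨e, he⟩ := represents_surjective ξ' δ'
    obtain ⟨h₁, h₂⟩ := (h e).unique_right he
    exact ⟨⟨e, (he.mem_extensionClasses_iff X S).2 hx⟩, Subtype.ext (Prod.ext h₂ h₁)⟩

end Complexes

/-! ### Counting classes in one degree -/

section LocalCount

variable {C : Type u} [Category.{v} C] [Abelian C]

lemma eulerForm_ne_zero (hHom : ∀ X Y : C, Finite (X ⟶ Y)) (hExt : ∀ X Y : C, Finite (Ext X Y 1))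
    (X Y : C) : eulerForm X Y ≠ 0 :=
  div_ne_zero (natCast_card_ne_zero _) (natCast_card_ne_zero _)

lemma autCard_ne_zero {D : Type u} [Category.{v} D] (hHom : ∀ X Y : D, Finite (X ⟶ Y))
    (X : D) : (autCard X : ℚ) ≠ 0 := by
  have : Finite (Aut X) := finite_iso X X
  exact natCast_card_ne_zero (Aut X)

/-- The factor at one degree that counts extension classes with prescribed homology. -/
noncomputable def classCount (A B M N S S' X : C) : ℚ :=
  hallNumber M N X * autCard M * autCard N * Nat.card (A ⟶ B) /
    (autCard X * eulerForm A S * eulerForm S' N)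

/-- Fibres of the surjective transfer map contribute `|Ext¹(A, B)| / |Ext¹(M, N)|`, Riedtmann's
formula a factor `|Hom(M, N)|`; together these are `|Hom(A, B)| ⟨M, N⟩ / ⟨A, B⟩`. -/
lemma card_extTransfer_mem (hHom : ∀ X Y : C, Finite (X ⟶ Y))
    (hExt : ∀ X Y : C, Finite (Ext X Y 1)) (hHer : ∀ X Y : C, Subsingleton (Ext X Y 2))
    {A B M N S S' : C} (X : C) {m : M ⟶ A} {r : A ⟶ S'} {w : m ≫ r = 0}
    (hm : (ShortComplex.mk m r w).ShortExact) {l : S ⟶ B} {q : B ⟶ N} {w' : l ≫ q = 0}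
    (hq : (ShortComplex.mk l q w').ShortExact) :
    (Nat.card {ξ : Ext A B 1 // extTransfer m q ξ ∈ extWithMiddle M N X} : ℚ) =
      classCount A B M N S S' X := by
  have : Mono m := hm.mono_f
  have : Epi q := hq.epi_g
  have h₁ := card_preimage_mul_card (extTransfer_surjective hHer m q) (extWithMiddle M N X)
  have h₂ := card_extWithMiddle_mul_autCard hHom M N X
  have h₃ := eulerForm_mul_left hExt hHer A hq
  have h₄ := eulerForm_mul_right hExt hHer N hm
  have n₁ := eulerForm_ne_zero hHom hExt A S
  have n₂ := eulerForm_ne_zero hHom hExt S' N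
  have n₃ := autCard_ne_zero hHom X
  have n₄ := natCast_card_ne_zero (Ext M N 1)
  have n₅ := natCast_card_ne_zero (Ext A B 1)
  have h₅ : eulerForm A B * Nat.card (Ext A B 1) = Nat.card (A ⟶ B) := div_mul_cancel₀ _ n₅
  have h₆ : eulerForm M N * Nat.card (Ext M N 1) = Nat.card (M ⟶ N) := div_mul_cancel₀ _ n₄
  have h₁' : (Nat.card {ξ : Ext A B 1 // extTransfer m q ξ ∈ extWithMiddle M N X} : ℚ) *
      Nat.card (Ext M N 1) = Nat.card (extWithMiddle M N X) * Nat.card (Ext A B 1) :=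
    mod_cast h₁
  have h₂' : (Nat.card (extWithMiddle M N X) : ℚ) * autCard X =
      hallNumber M N X * autCard N * autCard M * Nat.card (M ⟶ N) := mod_cast h₂
  rw [classCount, eq_div_iff (by positivity), ← h₅, h₃, h₄]
  rw [← h₆] at h₂'
  apply mul_right_cancel₀ n₄
  linear_combination (autCard X * eulerForm A S * eulerForm S' N) * h₁' +
    (Nat.card (Ext A B 1) * eulerForm A S * eulerForm S' N) * h₂'

lemma card_extTransfer_kernel_cokernel_mem (hHom : ∀ X Y : C, Finite (X ⟶ Y))
    (hExt : ∀ X Y : C, Finite (Ext X Y 1)) (hHer : ∀ X Y : C, Subsingleton (Ext X Y 2))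
    {A B U V M N S S' : C} (X : C) {f : A ⟶ V} {g : U ⟶ B} (a : kernel f ≅ M) (b : image f ≅ S')
    (c : image g ≅ S) (d : cokernel g ≅ N) :
    (Nat.card {ξ : Ext A B 1 // extTransfer (kernel.ι f) (cokernel.π g) ξ ∈
      extWithMiddle (kernel f) (cokernel g) X} : ℚ) = classCount A B M N S S' X := by
  have w : kernel.ι f ≫ factorThruImage f = 0 := by
    rw [← cancel_mono (Limits.image.ι f)]
    simp
  have hm : (ShortComplex.mk (a.inv ≫ kernel.ι f) (factorThruImage f ≫ b.hom)
      (by simp [reassoc_of% w])).ShortExact :=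
    ShortComplex.shortExact_of_iso (ShortComplex.isoMk (S₁ := ShortComplex.mk _ _ w)
      a (Iso.refl _) b (by simp) (by simp)) (shortExact_kernel_image f)
  have w' : Limits.image.ι g ≫ cokernel.π g = 0 := by
    rw [← cancel_epi (factorThruImage g)]
    simp
  have hq : (ShortComplex.mk (c.inv ≫ Limits.image.ι g) (cokernel.π g ≫ d.hom)
      (by simp [reassoc_of% w'])).ShortExact :=
    ShortComplex.shortExact_of_iso (ShortComplex.isoMk (S₁ := ShortComplex.mk _ _ w')
      c (Iso.refl _) d (by simp) (by simp)) (shortExact_image_cokernel g)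
  rw [← card_extTransfer_mem hHom hExt hHer X hm hq]
  congr 1
  refine Nat.card_congr (Equiv.subtypeEquivRight fun ξ => ?_)
  rw [← extTransfer_extTransfer (kernel.ι f) (cokernel.π g) a.inv d.hom]
  refine ⟨fun h => extTransfer_mem_of_iso a.symm d h, fun h => ?_⟩
  have := extTransfer_mem_of_iso a d.symm h
  rw [Iso.symm_hom, extTransfer_extTransfer, extTransfer_extTransfer] at this
  simpa using this

end LocalCount

/-! ### Sums by fibres and products over `ℤ/t` -/

section Sums

/-- Only values attained by `F` contribute, so the support is finite even if `β` is infinite. -/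
lemma sum_eq_finsum_of_fiberwise {α β : Type*} [Fintype α] (F : α → β) (c s : β → ℚ)
    (hs : ∀ b, s b = Nat.card {a // F a = b} * c b) :
    {b | s b ≠ 0}.Finite ∧ ∑ a, c (F a) = ∑ᶠ b, s b := by
  classical
  have hsub : Function.support s ⊆ ((Finset.univ.image F : Finset β) : Set β) := by
    intro b hb
    by_contra h
    have : IsEmpty {a // F a = b} := ⟨fun a => h (by simp [← a.2])⟩
    exact hb (by simp [hs])
  refine ⟨(Finset.finite_toSet _).subset hsub, ?_⟩
  rw [finsum_eq_sum_of_support_subset _ hsub, ← Finset.sum_fiberwise_of_maps_to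
    (fun a ha => Finset.mem_image_of_mem F ha) (fun a => c (F a))]
  refine Finset.sum_congr rfl fun b _ => ?_
  rw [Finset.sum_congr rfl fun a ha => congr_arg c (Finset.mem_filter.1 ha).2, Finset.sum_const,
    hs, nsmul_eq_mul, Nat.card_eq_fintype_card, Fintype.card_subtype]

/-- Sections over `ℤ/t` that satisfy a condition in each degree, indexed with a shift by `1`. -/
lemma card_pi_shift {t : ℕ} [NeZero t] {E : ZMod t → Type*} (Q : ∀ i, E (i + 1) → Prop) :
    Nat.card {ξ : ∀ i, E i // ∀ i, Q i (ξ (i + 1))} = ∏ i, Nat.card {x // Q i x} := by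
  have e : {ξ : ∀ i, E i // ∀ i, Q i (ξ (i + 1))} ≃ ∀ i, {x // Q i x} :=
    ((Equiv.piCongrLeft E (Equiv.addRight (1 : ZMod t))).symm.subtypeEquiv
      (q := fun η => ∀ i, Q i (η i)) fun ξ => Iff.rfl).trans Equiv.subtypePiEquivPi
  rw [Nat.card_congr e, Nat.card_pi]

end Sums

/-! ### Assembling all degrees -/

section GlobalCount

variable {C : Type u} [Category.{v} C] [Abelian C] {t : ℕ}

/-- The isomorphism classes of the kernels and the cokernels of a family of maps
`A₁ i ⟶ A₂ (i + 1)`. -/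
noncomputable def kernelCokernelClass {A₁ A₂ : ZMod t → C} (δ : ∀ i, A₁ i ⟶ A₂ (i + 1)) :
    (ZMod t → IsoClass C) × (ZMod t → IsoClass C) :=
  (fun i => ⟦kernel (δ i)⟧, fun i => ⟦cokernel (δ (i - 1))⟧)

lemma kernelCokernelClass_eq_iff {A₁ A₂ : ZMod t → C} (δ : ∀ i, A₁ i ⟶ A₂ (i + 1))
    (MN : (ZMod t → IsoClass C) × (ZMod t → IsoClass C)) :
    kernelCokernelClass δ = MN ↔ ∀ i, Nonempty (kernel (δ i) ≅ (MN.1 i).out) ∧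
      Nonempty (cokernel (δ i) ≅ (MN.2 (i + 1)).out) := by
  rw [Prod.ext_iff, funext_iff, funext_iff, forall_and]
  refine and_congr (forall_congr' fun i => Quotient.mk_eq_iff_out) ?_
  rw [← (Equiv.addRight (1 : ZMod t)).forall_congr_right]
  refine forall_congr' fun i => ?_
  -- The cokernel is indexed by the target degree, hence the shift.
  have h : (kernelCokernelClass δ).2 (i + 1) = ⟦cokernel (δ i)⟧ := by
    change (⟦cokernel (δ (i + 1 - 1))⟧ : IsoClass C) = _
    rw [add_sub_cancel_right]
  exact (Eq.congr_left h).trans Quotient.mk_eq_iff_out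

variable [NeZero t]

/-- Separates the count of `δ` from that of `ξ`; since `δ i` ends in degree `i + 1`, the factors at
`A₂` are reindexed cyclically. -/
lemma summand_eq (A₁ A₂ X S M N : ZMod t → C) :
    summand A₁ A₂ X S M N =
      (∏ i, (hallNumber (S (i + 1)) (M i) (A₁ i) *
        hallNumber (N (i + 1)) (S (i + 1)) (A₂ (i + 1)) * autCard (S (i + 1)) : ℕ) : ℚ) *
      ∏ i, classCount (A₁ i) (A₂ i) (M i) (N i) (S i) (S (i + 1)) (X i) := by
  have h : ∏ i, (hallNumber (N (i + 1)) (S (i + 1)) (A₂ (i + 1)) * autCard (S (i + 1)) : ℚ) =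
      ∏ i, (hallNumber (N i) (S i) (A₂ i) * autCard (S i) : ℚ) :=
    Equiv.prod_comp (Equiv.addRight (1 : ZMod t))
      fun i => (hallNumber (N i) (S i) (A₂ i) * autCard (S i) : ℚ)
  push_cast
  simp only [mul_assoc (hallNumber _ _ _ : ℚ)]
  rw [Finset.prod_mul_distrib, h, ← Finset.prod_mul_distrib, ← Finset.prod_mul_distrib, summand]
  exact Finset.prod_congr rfl fun i _ => by rw [classCount]; ring

lemma card_kernelCokernelClass_eq (hHom : ∀ X Y : C, Finite (X ⟶ Y)) (A₁ A₂ S : ZMod t → C)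
    (MN : (ZMod t → IsoClass C) × (ZMod t → IsoClass C)) :
    Nat.card {δ : {δ : ∀ i, A₁ i ⟶ A₂ (i + 1) // ∀ i, Nonempty (image (δ i) ≅ S (i + 1))} //
      kernelCokernelClass δ.1 = MN} =
    ∏ i, (hallNumber (S (i + 1)) (MN.1 i).out (A₁ i) *
        hallNumber (MN.2 (i + 1)).out (S (i + 1)) (A₂ (i + 1)) * autCard (S (i + 1))) := by
  have e := (Equiv.subtypeSubtypeEquivSubtypeInter
    (fun δ : ∀ i, A₁ i ⟶ A₂ (i + 1) => ∀ i, Nonempty (image (δ i) ≅ S (i + 1)))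
    (fun δ => kernelCokernelClass δ = MN)).trans
    ((Equiv.subtypeEquivRight (q := fun δ => ∀ i, Nonempty (kernel (δ i) ≅ (MN.1 i).out) ∧
      Nonempty (image (δ i) ≅ S (i + 1)) ∧ Nonempty (cokernel (δ i) ≅ (MN.2 (i + 1)).out))
      fun δ => by
        rw [kernelCokernelClass_eq_iff, ← forall_and]
        exact forall_congr' fun i => by tauto).trans
      (Equiv.subtypePiEquivPi (p := fun {i} (f : A₁ i ⟶ A₂ (i + 1)) =>
        Nonempty (kernel f ≅ (MN.1 i).out) ∧ Nonempty (image f ≅ S (i + 1)) ∧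
          Nonempty (cokernel f ≅ (MN.2 (i + 1)).out))))
  rw [Nat.card_congr e, Nat.card_pi]
  exact Finset.prod_congr rfl fun i _ => card_hom_kernel_image_cokernel hHom _ _ _ _ _

/-- Once `δ` is fixed, the conditions on the `ξ i` are independent of one another, and their count
depends on `δ` only through kernels, images and cokernels. -/
lemma card_admissible (hHom : ∀ X Y : C, Finite (X ⟶ Y))
    (hExt : ∀ X Y : C, Finite (Ext X Y 1)) (hHer : ∀ X Y : C, Subsingleton (Ext X Y 2))
    {A₁ A₂ : ZMod t → C} (X S M N : ZMod t → C) {δ : ∀ i, A₁ i ⟶ A₂ (i + 1)}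
    (hδ : ∀ i, Nonempty (image (δ i) ≅ S (i + 1)))
    (hMN : ∀ i, Nonempty (kernel (δ i) ≅ M i) ∧ Nonempty (cokernel (δ i) ≅ N (i + 1))) :
    (Nat.card {ξ : ∀ i, Ext (A₁ i) (A₂ i) 1 // Admissible X S ξ δ} : ℚ) =
      ∏ i, classCount (A₁ i) (A₂ i) (M i) (N i) (S i) (S (i + 1)) (X i) := by
  have h₀ : ∀ ξ : ∀ i, Ext (A₁ i) (A₂ i) 1, Admissible X S ξ δ ↔ _ := fun ξ => and_iff_right hδ
  have h₁ : ∏ i, classCount (A₁ (i + 1)) (A₂ (i + 1)) (M (i + 1)) (N (i + 1)) (S (i + 1))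
      (S (i + 1 + 1)) (X (i + 1)) =
      ∏ i, classCount (A₁ i) (A₂ i) (M i) (N i) (S i) (S (i + 1)) (X i) :=
    Equiv.prod_comp (Equiv.addRight (1 : ZMod t))
      fun i => classCount (A₁ i) (A₂ i) (M i) (N i) (S i) (S (i + 1)) (X i)
  rw [Nat.card_congr (Equiv.subtypeEquivRight h₀), card_pi_shift
    (E := fun i => Ext (A₁ i) (A₂ i) 1) fun i ξ =>
      extTransfer (kernel.ι (δ (i + 1))) (cokernel.π (δ i)) ξ ∈
        extWithMiddle (kernel (δ (i + 1))) (cokernel (δ i)) (X (i + 1)), Nat.cast_prod, ← h₁]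
  refine Finset.prod_congr rfl fun i _ => ?_
  obtain ⟨a⟩ := (hMN (i + 1)).1
  obtain ⟨b⟩ := hδ (i + 1)
  obtain ⟨c⟩ := hδ i
  obtain ⟨d⟩ := (hMN i).2
  exact card_extTransfer_kernel_cokernel_mem hHom hExt hHer _ a b c d

end GlobalCount

end PeriodicHall

theorem proposition5p6
    {k : Type*} [Field k] [Finite k]
    {A : Type u} [Category.{v} A] [Abelian A] [Linear k A]
    -- `A` is finitary:
    (hHom : ∀ X Y : A, Finite (X ⟶ Y))
    (hExt : ∀ X Y : A, Finite (Ext X Y 1))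
    -- `A` is hereditary:
    (hHer : ∀ X Y : A, Subsingleton (Ext X Y 2))
    (t : ℕ) [NeZero t]
    (A₁ A₂ X S : ZMod t → A) :
    (PeriodicHall.extensionClasses A₁ A₂ X S).Finite ∧
    {MN : (ZMod t → PeriodicHall.IsoClass A) × (ZMod t → PeriodicHall.IsoClass A) |
      PeriodicHall.summand A₁ A₂ X S (fun i => (MN.1 i).out) (fun i => (MN.2 i).out) ≠ 0}.Finite ∧
    ((PeriodicHall.extensionClasses A₁ A₂ X S).ncard : ℚ) =
      ∑ᶠ MN : (ZMod t → PeriodicHall.IsoClass A) × (ZMod t → PeriodicHall.IsoClass A),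
        PeriodicHall.summand A₁ A₂ X S (fun i => (MN.1 i).out) (fun i => (MN.2 i).out) := by
  obtain ⟨e⟩ := PeriodicHall.nonempty_extensionClasses_equiv (A₁ := A₁) (A₂ := A₂) X S
  let D := {δ : ∀ i, A₁ i ⟶ A₂ (i + 1) // ∀ i, Nonempty (image (δ i) ≅ S (i + 1))}
  have : Fintype D := Fintype.ofFinite D
  -- Pairs `(δ, ξ)` are fibred over the finite set of `δ` with the right images.
  let e' : {x : (∀ i, A₁ i ⟶ A₂ (i + 1)) × (∀ i, Ext (A₁ i) (A₂ i) 1) //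
      PeriodicHall.Admissible X S x.2 x.1} ≃
      Σ δ : D, {ξ : ∀ i, Ext (A₁ i) (A₂ i) 1 // PeriodicHall.Admissible X S ξ δ.1} :=
    { toFun := fun x => ⟨⟨x.1.1, x.2.1⟩, x.1.2, x.2⟩
      invFun := fun x => ⟨(x.1.1, x.2.1), x.2.2⟩
      left_inv := fun _ => rfl
      right_inv := fun _ => rfl }
  have hfin : Finite (PeriodicHall.extensionClasses A₁ A₂ X S) := Finite.of_equiv _ e.symm
  have key := PeriodicHall.sum_eq_finsum_of_fiberwise
    (fun δ : D => PeriodicHall.kernelCokernelClass δ.1)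
    (fun MN => ∏ i, PeriodicHall.classCount (A₁ i) (A₂ i) (MN.1 i).out (MN.2 i).out (S i)
      (S (i + 1)) (X i))
    (fun MN => PeriodicHall.summand A₁ A₂ X S (fun i => (MN.1 i).out) (fun i => (MN.2 i).out))
    (fun MN => by
      rw [PeriodicHall.card_kernelCokernelClass_eq hHom, PeriodicHall.summand_eq]
      push_cast
      rfl)
  refine ⟨Set.toFinite _, key.1, ?_⟩
  rw [← key.2, ← Nat.card_coe_set_eq, Nat.card_congr (e.trans e'), Nat.card_sigma, Nat.cast_sum]
  refine Finset.sum_congr rfl fun δ _ => ?_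
  exact PeriodicHall.card_admissible hHom hExt hHer X S _ _ δ.2
    ((PeriodicHall.kernelCokernelClass_eq_iff δ.1 _).1 rfl)
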